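/- **Conventions.** Codes are linear codes over finite fields. An $[n,k,d]_\Sigma$ code has length $n$, dimension $k$ and minimum Hamming distance $d$; $\delta_C(r)$ is the minimum relative Hamming distance of the word $r$ from a codeword of $C$. For $C\subseteq\Sigma^n$, the tensor power $C^m\subseteq\Sigma^{[n]^m}$ is the span of the words $(x_1,\dots,x_m)\mapsto c_1(x_1)\cdots c_m(x_m)$ with $c_1,\dots,c_m\in C$. A (non-adaptive) *tester* $T$ making $q$ queries draws a uniformly random string $s$, which determines $q$ positions and a set of accepted answers. It *tests* $C$ if it accepts every $r\in C$ with probability $1$ and rejects every $r\notin C$ with probability at least $\delta_C(r)/2$. It is *$\alpha$-robust* for $C$ if it accepts every $r\in C$ with probability $1$ and, for every word $r$, the expected relative distance of the answers read from $r$ to the set of accepted answers is at least $\alpha\,\delta_C(r)$. For an ordered bipartite graph $G$ (each right vertex $j$ has an ordered list $\ell_j$ of $D$ left vertices) and a code $S\subseteq\Sigma^D$, let $\mathrm{TPC}(G,S)=\{r: r|_{\ell_j}\in S\text{ for all }j\}$. Its test picks a uniformly random $j$ and verifies $r|_{\ell_j}\in S$. The composition of $G$ with $G'$ (whose left vertices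 are the positions $1,\dots,D$) has right vertices $(j,j')$ and lists $\ell''_{(j,j'),a}=\ell_{j,\ell'_{j',a}}$. Let $G^n_m$ have left vertices $[n]^m$ and right vertices $(b,i)\in[m]\times[n]$, where $(b,i)$ is adjacent to the points whose $b$-th coordinate is $i$; let $G^n_{4,2}$ be the composition of $G^n_4$ with $G^n_3$. Finally let $H^n_2=G^n_{4,2}$ and, for $t>2$, let $H^n_t$ be the composition of $G^{n^{2^{t-2}}}_{4,2}$ with $H^n_{t-1}$, where $[n^{2^{t-2}}]$ is identified with $[n]^{2^{t-2}}$. **Theorem.** Let $(C_i)_{i\in\mathbb N}$ be a family of codes, $C_i$ an $[n_i,k_i,d_i]_{\Sigma_i}$ linear code over a finite field $\Sigma_i$, with $k_i\ge 2$ and $n_i\le p(k_i)$ for a fixed polynomial $p$. Let $t_i\ge 0$ be integers such that $m_i=2^{t_i}$ satisfies $d_i/n_i\ge 1-\frac1{7m_i}$. Put $C_i'=C_i^{m_i}$, $N_i=n_i^{m_i}$ (its length) and $K_i=\dim C_i'$. Then: 1. (Inverse polynomial rate) there is a constant $c$ with $N_i\le K_i^{c}$ for all $i$. 2. (Constant relative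 distance) there is $\delta>0$ such that $C_i'$ has relative distance at least $\delta$ for all $i$. 3. (Local testability) there are testers $T_i$ and a constant $\alpha>0$ such that: * for all $i$, $T_i$ tests $C'_i$; * whenever $t_i\ge 2$: $C_i'=\mathrm{TPC}(H^{n_i}_{t_i},C_i^2)$, the test associated with $(H^{n_i}_{t_i},C_i^2)$ is $\alpha^{t_i}$-robust for $C_i'$, and $T_i$ runs that test independently some number of times and accepts if all the runs accept; * there are constants $B,b$ such that for all $i$ the tester $T_i$ makes at most $B\,n_i^2\,m_i^{b}$ queries; * consequently the number of queries is polylogarithmic when $n_i$ is polylogarithmic in $N_i$: if there are constants $A,a$ with $n_i\le A(\log N_i)^a$ for all $i$, then there are constants $B',b'$ such that, for all $i$, $T_i$ makes at most $B'(\log N_i)^{b'}$ queries. -/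

import Mathlib

namespace TensorLTC

universe u

/-! ### Codes and distances -/

section Codes

variable {F : Type u} {ι : Type}

open Classical in
/-- The relative Hamming distance of two words. -/
noncomputable def relDist [Fintype ι] (x y : ι → F) : ℝ :=
  (hammingDist x y : ℝ) / (Fintype.card ι : ℝ)

/-- The relative distance of the word `r` from the code `C`: the minimum of the relative
distances of `r` from the elements of `C`. -/
noncomputable def distToCode [Fintype ι] (C : Set (ι → F)) (r : ι → F) : ℝ :=
  ⨅ x : C, relDist r (x : ι → F)

open Classical in
/-- The minimum distance of a code: the least Hamming distance of two distinct codewords. -/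
noncomputable def minDist [Fintype ι] (C : Set (ι → F)) : ℕ :=
  sInf {d : ℕ | ∃ x ∈ C, ∃ y ∈ C, x ≠ y ∧ hammingDist x y = d}

/-- The `m`-th tensor power of a linear code `C` with coordinate set `ι`: the linear code with
coordinate set `ι ^ m` spanned by the words `(x₁, …, xₘ) ↦ c₁(x₁) ⋯ cₘ(xₘ)` with all `cⱼ ∈ C`. -/
def tensorPower [Field F] (C : Submodule F (ι → F)) (m : ℕ) :
    Submodule F ((Fin m → ι) → F) :=
  Submodule.span F
    {w | ∃ c : Fin m → ι → F, (∀ j, c j ∈ C) ∧ w = fun x => ∏ j, c j (x j)}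

end Codes

/-! ### Testers -/

/-- A non-adaptive tester for words with alphabet `F` and coordinate set `ι`: a uniformly random
`s : Ω` determines the queried coordinates (indexed by the finite set `Q`, so that the number of
queries is the cardinality of `Q`) and the set of the answers that are accepted. -/
structure Tester (F : Type u) (ι : Type) where
  Ω : Type
  Q : Type
  [fintypeΩ : Fintype Ω]
  [nonemptyΩ : Nonempty Ω]
  [fintypeQ : Fintype Q]
  query : Ω → Q → ι
  accept : Ω → Set (Q → F)

attribute [instance] Tester.fintypeΩ Tester.nonemptyΩ Tester.fintypeQ

namespace Tester

variable {F : Type u} {ι : Type}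

/-- The query complexity. -/
def numQueries (T : Tester F ι) : ℕ := Fintype.card T.Q

/-- The answers that the tester receives from the word `r` when its random string is `s`. -/
def view (T : Tester F ι) (r : ι → F) (s : T.Ω) : T.Q → F := fun a => r (T.query s a)

/-- The tester accepts `r` on random string `s`. -/
def Accepts (T : Tester F ι) (r : ι → F) (s : T.Ω) : Prop := T.view r s ∈ T.accept s

/-- The probability, over the random string, that the tester rejects `r`. -/
noncomputable def rejectProb (T : Tester F ι) (r : ι → F) : ℝ :=
  (Nat.card {s : T.Ω // ¬ T.Accepts r s} : ℝ) / (Fintype.card T.Ω : ℝ)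

/-- `T` tests the code `C`: codewords are always accepted, and every other word `r` is rejected
with probability at least half its relative distance from `C`. -/
def Tests [Fintype ι] (T : Tester F ι) (C : Set (ι → F)) : Prop :=
  (∀ r ∈ C, ∀ s, T.Accepts r s) ∧ ∀ r, r ∉ C → distToCode C r / 2 ≤ T.rejectProb r

/-- The expected robustness of `T` on `r`: the average, over the random string `s`, of the relative
distance of the answers from the set of the answers accepted on `s`. -/
noncomputable def robustness (T : Tester F ι) (r : ι → F) : ℝ :=
  (∑ s : T.Ω, distToCode (T.accept s) (T.view r s)) / (Fintype.card T.Ω : ℝ)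

/-- `T` is an `α`-robust tester for the code `C`. -/
def IsRobust [Fintype ι] (T : Tester F ι) (α : ℝ) (C : Set (ι → F)) : Prop :=
  (∀ r ∈ C, ∀ s, T.Accepts r s) ∧ ∀ r, α * distToCode C r ≤ T.robustness r

/-- Invoke `T` independently `c` times, and accept if all the invocations accept. -/
def iterate (T : Tester F ι) (c : ℕ) : Tester F ι where
  Ω := Fin c → T.Ω
  Q := Fin c × T.Q
  query s a := T.query (s a.1) a.2
  accept s := {x | ∀ j, (fun a => x (j, a)) ∈ T.accept (s j)}

end Tester

/-! ### Ordered bipartite graphs and Tanner products -/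

/-- An ordered bipartite graph with set of left vertices `L`, a finite set `R` of right vertices,
and for each right vertex a sequence of neighbours indexed by `D`. -/
structure OrderedGraph (L D : Type) where
  R : Type
  [fintypeR : Fintype R]
  [nonemptyR : Nonempty R]
  nbr : R → D → L

attribute [instance] OrderedGraph.fintypeR OrderedGraph.nonemptyR

namespace OrderedGraph

variable {L D : Type}

/-- The Tanner product code: the words whose projection to the neighbourhood of every right vertex
lies in the small code `S`. -/
def TPC {F : Type u} (G : OrderedGraph L D) (S : Set (D → F)) : Set (L → F) :=
  {r | ∀ j : G.R, (fun a => r (G.nbr j a)) ∈ S}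

/-- The test associated with a Tanner product: pick a random right vertex and verify that the
projection to its neighbourhood lies in the small code. -/
def tester {F : Type u} [Fintype D] (G : OrderedGraph L D) (S : Set (D → F)) : Tester F L where
  Ω := G.R
  Q := D
  query := G.nbr
  accept _ := S

/-- The Tanner composition of two ordered graphs. -/
def comp {D' : Type} (G : OrderedGraph L D) (G' : OrderedGraph D D') : OrderedGraph L D' where
  R := G.R × G'.R
  nbr j a := G.nbr j.1 (G'.nbr j.2 a)

/-- Rename the left vertices and the positions in the neighbourhoods. -/
def relabel {L' D' : Type} (G : OrderedGraph L D) (e : L ≃ L') (f : D ≃ D') :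
    OrderedGraph L' D' where
  R := G.R
  nbr j a := e (G.nbr j (f.symm a))

end OrderedGraph

section Graphs

variable (A : Type) [Fintype A] [Nonempty A]

/-- The graph of the `(m+1)`-product tester: the neighbours of the right vertex `(b, i)` are the
points of `A ^ (m+1)` whose `b`-th coordinate is `i`, in the order of their other coordinates. -/
def productGraph (m : ℕ) : OrderedGraph (Fin (m + 1) → A) (Fin m → A) where
  R := Fin (m + 1) × A
  nbr j x := j.1.insertNth j.2 x

/-- The graph that reduces a fourth tensor power to the second one. -/
def graphFourTwo : OrderedGraph (Fin 4 → A) (Fin 2 → A) :=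
  (productGraph A 3).comp (productGraph A 2)

variable {A} in
/-- The identification of `(A ^ M) ^ k` with `A ^ (k * M)`. -/
def blockEquiv {k M N : ℕ} (h : k * M = N) : (Fin k → Fin M → A) ≃ (Fin N → A) :=
  (Equiv.curry (Fin k) (Fin M) A).symm.trans
    ((finProdFinEquiv.trans (finCongr h)).arrowCongr (Equiv.refl A))

/-- The recursively composed graphs that reduce the `2 ^ t`-th tensor power to the second one.
For `t = 2` it is `graphFourTwo A`; for `t > 2` it is the composition of the graph `graphFourTwo`
over the set `A ^ (2 ^ (t - 2))` with the graph for `t - 1`. -/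
def recGraph : (t : ℕ) → 2 ≤ t → OrderedGraph (Fin (2 ^ t) → A) (Fin 2 → A)
  | 0, h => absurd h (by decide)
  | 1, h => absurd h (by decide)
  | 2, _ => graphFourTwo A
  | t + 3, _ =>
    ((graphFourTwo (Fin (2 ^ (t + 1)) → A)).relabel
      (blockEquiv (N := 2 ^ (t + 3)) (by ring))
      (blockEquiv (N := 2 ^ (t + 2)) (by ring))).comp (recGraph (t + 2) (by omega))

end Graphs

end TensorLTC

/-! The tensor power is exactly the code of words all of whose axis-parallel lines lie in `C`
(`tensorPower_eq_lineCode`). Dimension at least `k ^ m` comes from products of basis words. Weight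
at least `d ^ m` comes from counting along lines, and Bernoulli's inequality then keeps the relative
distance at least 6/7.

The core of testability is the robustness of the hyperplane test (`MinWeight.exists_numDiff_le`).
Replace every hyperplane of `r` by a nearest codeword; each direction `b` then gives a word `g b`
that is correct along all directions but `b`. Three directions suffice. If many hyperplanes of `g₀`
or `g₁` conflict with many hyperplanes of `g₂`, then these words differ in a constant fraction of
the points, `r` is far from one of them, and the zero codeword is already a good enough
approximation. Otherwise `g₂` serves as arbiter: outside few hyperplanes it forces `g₀ = g₁`, and
erasure decoding of the remaining hyperplanes extends the common part to a codeword close to `r`.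

Two such tests reduce the fourth power to the square with robustness 1/300. Reading `C ^ (2 ^ t)` as
the fourth power of `C ^ (2 ^ (t - 2))`, the same reduction halves the exponent. Robustness
multiplies under composition (`isRobust_comp`), so the square is reached with robustness at least
`(1 / 300) ^ t`, and `300 ^ t` repetitions, a polynomial number in `m = 2 ^ t`, give the required
soundness. -/

namespace TensorLTC

universe u

/-! ### Tensor powers described by axis-parallel lines; dimension -/

section LineCode

variable {F : Type u} {A κ : Type} [Field F]

/-- The words on `A ^ κ` whose restrictions to all axis-parallel lines with direction in `S` are
codewords of `C`. -/
def lineCode [DecidableEq κ] (C : Submodule F (A → F)) (S : Set κ) :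
    Submodule F ((κ → A) → F) where
  carrier := {w | ∀ c ∈ S, ∀ y, (fun a => w (Function.update y c a)) ∈ C}
  add_mem' hv hw c hc y := C.add_mem (hv c hc y) (hw c hc y)
  zero_mem' _ _ _ := C.zero_mem
  smul_mem' k _ hw c hc y := C.smul_mem k (hw c hc y)

theorem mem_lineCode [DecidableEq κ] {C : Submodule F (A → F)} {S : Set κ} {w : (κ → A) → F} :
    w ∈ lineCode C S ↔ ∀ c ∈ S, ∀ y, (fun a => w (Function.update y c a)) ∈ C :=
  Iff.rfl

theorem lineCode_anti [DecidableEq κ] (C : Submodule F (A → F)) {S S' : Set κ} (h : S ⊆ S') :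
    lineCode C S' ≤ lineCode C S :=
  fun _ hw c hc => hw c (h hc)

/-- A code with no nonzero codeword vanishing on `I` has a linear decoder from erasures
outside `I`. -/
theorem exists_erasure_decoder (C : Submodule F (A → F)) (I : Set A)
    (hI : ∀ c ∈ C, (∀ a ∈ I, c a = 0) → c = 0) :
    ∃ E : (A → F) →ₗ[F] (A → F), (∀ f, E f ∈ C) ∧
      ∀ f, ∀ c ∈ C, (∀ a ∈ I, f a = c a) → E f = c := by
  let ρ : (A → F) →ₗ[F] (I → F) := LinearMap.funLeft F F Subtype.val
  have hinj : LinearMap.ker (ρ ∘ₗ C.subtype) = ⊥ := by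
    rw [LinearMap.ker_eq_bot']
    intro c hc
    refine Subtype.ext (hI c c.2 fun a ha => ?_)
    exact congrFun hc ⟨a, ha⟩
  obtain ⟨g, hg⟩ := LinearMap.exists_leftInverse_of_injective _ hinj
  refine ⟨C.subtype ∘ₗ g ∘ₗ ρ, fun f => (g (ρ f)).2, fun f c hc h => ?_⟩
  have h1 : ρ f = (ρ ∘ₗ C.subtype) ⟨c, hc⟩ := funext fun a => h a a.2
  have h2 : g (ρ f) = ⟨c, hc⟩ := by
    rw [h1]
    exact LinearMap.congr_fun hg ⟨c, hc⟩
  simp [h2]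

theorem linearMap_apply_eq_sum [Fintype A] [DecidableEq A] (E : (A → F) →ₗ[F] (A → F))
    (f : A → F) (y : A) : E f y = ∑ z, f z * E (Pi.single z 1) y := by
  conv_lhs => rw [← LinearMap.sum_single_apply (fun _ => F) f, map_sum, Finset.sum_apply]
  refine Finset.sum_congr rfl fun z _ => ?_
  have h : (Pi.single z (f z) : A → F) = f z • Pi.single z 1 := by
    rw [← Pi.single_smul, smul_eq_mul, mul_one]
  simp [h]

/-- The left side is the tensor power of `E` applied to `w`, that is, `E` applied along each
coordinate in turn. Since `E` fixes `C` and every line of `w` lies in `C`, no application changes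
`w`. The induction splits off the first coordinate. -/
theorem sum_mul_prod_of_mem_lineCode [Fintype A] [DecidableEq A] (C : Submodule F (A → F))
    (E : (A → F) →ₗ[F] (A → F)) (hE : ∀ c ∈ C, E c = c) :
    ∀ (m : ℕ) (w : (Fin m → A) → F), w ∈ lineCode C Set.univ → ∀ y,
      ∑ z, w z * ∏ j, E (Pi.single (z j) 1) (y j) = w y := by
  intro m
  induction m with
  | zero =>
    intro w _ y
    simp [Subsingleton.elim default y]
  | succ m ih =>
    intro w hw y
    have hcons : ∀ a, (fun z => w (Fin.cons a z)) ∈ lineCode C (Set.univ : Set (Fin m)) := by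
      intro a c _ z
      simpa only [Fin.cons_update] using hw c.succ trivial (Fin.cons a z)
    have hline : (fun a => w (Fin.cons a (Fin.tail y))) ∈ C := by
      simpa only [Fin.update_cons_zero] using hw 0 trivial (Fin.cons (y 0) (Fin.tail y))
    rw [← (Fin.consEquiv (fun _ : Fin (m + 1) => A)).sum_comp, Fintype.sum_prod_type]
    have h1 : ∀ a, ∑ z : Fin m → A, w (Fin.cons a z) *
        ∏ j, E (Pi.single ((Fin.cons a z : Fin (m + 1) → A) j) 1) (y j) =
        w (Fin.cons a (Fin.tail y)) * E (Pi.single a 1) (y 0) := by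
      intro a
      rw [← ih _ (hcons a) (Fin.tail y), Finset.sum_mul]
      refine Finset.sum_congr rfl fun z _ => ?_
      rw [Fin.prod_univ_succ]
      simp only [Fin.cons_zero, Fin.cons_succ, Fin.tail]
      ring
    have h2 := linearMap_apply_eq_sum E (fun a => w (Fin.cons a (Fin.tail y))) (y 0)
    rw [hE _ hline] at h2
    beta_reduce at h2
    rw [Fin.cons_self_tail] at h2
    rw [h2]
    exact Finset.sum_congr rfl fun a _ => h1 a

theorem tensorPower_eq_lineCode [Fintype A] (C : Submodule F (A → F)) (m : ℕ) :
    tensorPower C m = lineCode C Set.univ := by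
  classical
  apply le_antisymm
  · refine Submodule.span_le.2 ?_
    rintro _ ⟨c, hc, rfl⟩ b _ y
    have h : (fun a => ∏ j, c j (Function.update y b a j)) =
        (∏ j ∈ Finset.univ.erase b, c j (y j)) • c b := by
      funext a
      rw [← Finset.prod_erase_mul _ _ (Finset.mem_univ b)]
      simp only [Function.update_self, Pi.smul_apply, smul_eq_mul]
      congr 1
      refine Finset.prod_congr rfl fun j hj => ?_
      rw [Function.update_of_ne (Finset.ne_of_mem_erase hj)]
    show (fun a => ∏ j, c j (Function.update y b a j)) ∈ C
    rw [h]
    exact C.smul_mem _ (hc b)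
  · intro w hw
    -- With nothing erased, the decoder is a linear projection onto `C`; its tensor power writes `w`
    -- as a combination of product words.
    obtain ⟨E, hEC, hE⟩ := exists_erasure_decoder C Set.univ
      fun c _ h => funext fun a => h a trivial
    have h : w = ∑ z, w z • fun y => ∏ j, E (Pi.single (z j) 1) (y j) := by
      funext y
      rw [Finset.sum_apply]
      exact (sum_mul_prod_of_mem_lineCode C E
        (fun c hc => hE c c hc fun _ _ => rfl) m w hw y).symm
    rw [h]
    exact Submodule.sum_mem _ fun z _ => Submodule.smul_mem _ _
      (Submodule.subset_span ⟨_, fun j => hEC _, rfl⟩)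

/-- Products of basis words are independent, because products of the coordinate functionals,
extended from `C` to the whole space, form a dual family. -/
theorem pow_finrank_le_finrank_tensorPower [Fintype A] (C : Submodule F (A → F)) (m : ℕ) :
    Module.finrank F C ^ m ≤ Module.finrank F (tensorPower C m) := by
  classical
  let b := Module.finBasis F C
  have hφ : ∀ a, ∃ φ : (A → F) →ₗ[F] F, φ ∘ₗ C.subtype = b.coord a :=
    fun a => LinearMap.exists_extend _
  choose φ hφ using hφ
  have hφb : ∀ a a', ∑ z, φ a (Pi.single z 1) * (b a' : A → F) z = if a = a' then 1 else 0 := by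
    intro a a'
    have h := LinearMap.congr_fun (hφ a) (b a')
    simp only [LinearMap.comp_apply, Submodule.subtype_apply, Module.Basis.coord_apply,
      Module.Basis.repr_self, Finsupp.single_apply] at h
    rw [LinearMap.pi_apply_eq_sum_univ (φ a)] at h
    simp only [smul_eq_mul] at h
    simpa [mul_comm, eq_comm, ← Pi.single_apply, Pi.single_comm] using h
  let w : (Fin m → Fin (Module.finrank F C)) → (Fin m → A) → F :=
    fun a x => ∏ j, (b (a j) : A → F) (x j)
  let Φ : (Fin m → Fin (Module.finrank F C)) → Module.Dual F ((Fin m → A) → F) :=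
    fun a => ∑ z, (∏ j, φ (a j) (Pi.single (z j) 1)) • LinearMap.proj z
  have hΦ : ∀ a a', Φ a (w a') = ∏ j, if a j = a' j then 1 else 0 := by
    intro a a'
    simp only [Φ, w, LinearMap.sum_apply, LinearMap.smul_apply, LinearMap.proj_apply, smul_eq_mul,
      ← Finset.prod_mul_distrib, ← hφb]
    rw [Finset.prod_univ_sum, Fintype.piFinset_univ]
  have hli : LinearIndependent F w := by
    refine LinearIndependent.of_pairwise_dual_eq_zero_one w Φ ?_ ?_
    · intro a a' h
      obtain ⟨j, hj⟩ := Function.ne_iff.1 h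
      rw [hΦ]
      exact Finset.prod_eq_zero (Finset.mem_univ j) (if_neg hj)
    · intro a
      simp [hΦ]
  have hspan : Submodule.span F (Set.range w) ≤ tensorPower C m := by
    refine Submodule.span_mono ?_
    rintro _ ⟨a, rfl⟩
    exact ⟨fun j => b (a j), fun j => (b (a j)).2, rfl⟩
  have h := Submodule.finrank_mono hspan
  rw [finrank_span_eq_card hli] at h
  simpa using h

end LineCode

/-! ### Weights of words with prescribed line directions -/

section Weight

open Finset

theorem card_mul_le_of_le_fiber {α β : Type} [DecidableEq α] (f : β → α) (L : Finset α)
    (X : Finset β) (k c : ℕ) (h : ∀ a ∈ L, k ≤ c * #{q ∈ X | f q = a}) : #L * k ≤ c * #X := by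
  calc #L * k ≤ ∑ a ∈ L, c * #{q ∈ X | f q = a} := by
        simpa using Finset.card_nsmul_le_sum L _ k h
    _ = c * #{q ∈ X | f q ∈ L} := by
        rw [← Finset.mul_sum, Finset.card_eq_sum_card_fiberwise (f := f) (t := L)]
        · congr 1
          refine Finset.sum_congr rfl fun a ha => ?_
          congr 1
          ext q
          simp only [mem_filter]
          constructor
          · rintro ⟨h1, rfl⟩
            exact ⟨⟨h1, ha⟩, rfl⟩
          · rintro ⟨⟨h1, _⟩, h2⟩
            exact ⟨h1, h2⟩
        · intro q hq
          simpa using (mem_filter.1 hq).2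
    _ ≤ c * #X := Nat.mul_le_mul_left _ (card_le_card (filter_subset _ _))

open Classical in
/-- Every nonzero codeword of `C` has weight at least `d`. -/
def MinWeight {F : Type u} {A : Type} [Field F] [Fintype A] (C : Submodule F (A → F)) (d : ℕ) :
    Prop :=
  ∀ c ∈ C, c ≠ 0 → d ≤ #{a | c a ≠ 0}

variable {F : Type u} {A κ : Type} [Field F] [Fintype A]

theorem MinWeight.eq_zero {C : Submodule F (A → F)} {d : ℕ} (hC : MinWeight C d) {H : Finset A}
    (hH : #H < d) {c : A → F} (hc : c ∈ C) (h : ∀ a ∉ H, c a = 0) : c = 0 := by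
  classical
  by_contra h0
  have h1 : #{a | c a ≠ 0} ≤ #H := card_le_card fun a ha => by
    by_contra h2
    exact (mem_filter.1 ha).2 (h a h2)
  have h2 := hC c hc h0
  have h3 : d ≤ #{a | c a ≠ 0} := by convert h2
  omega

open Classical in
-- The line through `p` in a new direction has at least `d` nonzero points, and by induction each of
-- them contributes `d ^ #S` nonzero points in its own parallel slice. Fixing the slice through `p`
-- is what allows counting inside intersections of hyperplanes later.
theorem MinWeight.pow_card_le [Fintype κ] [DecidableEq κ] {C : Submodule F (A → F)} {d : ℕ}
    (hC : MinWeight C d) (S : Finset κ) :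
    ∀ w ∈ lineCode C (S : Set κ), ∀ p, w p ≠ 0 →
      d ^ #S ≤ #{q | w q ≠ 0 ∧ ∀ c ∉ S, q c = p c} := by
  induction S using Finset.induction_on with
  | empty =>
    intro w _ p hp
    simp only [card_empty, pow_zero, Nat.one_le_iff_ne_zero, ← Nat.pos_iff_ne_zero, card_pos]
    exact ⟨p, by simp [hp]⟩
  | insert s S hs ih =>
    intro w hw p hp
    have hline := hC _ (hw s (by simp) p) fun h => hp (by simpa using congrFun h (p s))
    have hw' : w ∈ lineCode C (S : Set κ) := lineCode_anti C (by simp) hw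
    have h := card_mul_le_of_le_fiber (fun q : κ → A => q s)
      {a | w (Function.update p s a) ≠ 0}
      {q | w q ≠ 0 ∧ ∀ c ∉ insert s S, q c = p c} (d ^ #S) 1 fun a ha => by
        rw [one_mul]
        refine (ih w hw' _ (mem_filter.1 ha).2).trans (card_le_card fun q hq => ?_)
        simp only [mem_filter, mem_univ, true_and, mem_insert, not_or] at hq ⊢
        refine ⟨⟨hq.1, fun c hc => ?_⟩, ?_⟩
        · rw [hq.2 c hc.2, Function.update_of_ne hc.1]
        · rw [hq.2 s hs, Function.update_self]
    rw [card_insert_of_notMem hs, pow_succ']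
    rw [one_mul] at h
    exact (Nat.mul_le_mul_right _ hline).trans h

theorem MinWeight.lineCode_univ [Fintype κ] [DecidableEq κ] {C : Submodule F (A → F)} {d : ℕ}
    (hC : MinWeight C d) : MinWeight (lineCode C (Set.univ : Set κ)) (d ^ Fintype.card κ) := by
  classical
  intro w hw h0
  obtain ⟨p, hp⟩ := Function.ne_iff.1 h0
  have h := hC.pow_card_le (univ : Finset κ) w (by convert hw using 2; simp) p hp
  simpa using h

end Weight

end TensorLTC

namespace TensorLTC

universe u

/-! ### From hyperplanewise codewords to a global codeword -/

section Agreement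

open Finset

open Classical in
/-- The number of coordinates at which two words differ. -/
noncomputable def numDiff {F : Type u} {X : Type} [Fintype X] (x y : X → F) : ℕ :=
  #{p | x p ≠ y p}

theorem numDiff_comm {F : Type u} {X : Type} [Fintype X] (x y : X → F) :
    numDiff x y = numDiff y x := by
  unfold numDiff
  congr 1
  ext p
  simp [ne_comm]

theorem numDiff_triangle {F : Type u} {X : Type} [Fintype X] (x y z : X → F) :
    numDiff x z ≤ numDiff x y + numDiff y z := by
  classical
  unfold numDiff
  refine (card_le_card fun p hp => ?_).trans (card_union_le _ _)
  simp only [mem_filter, mem_univ, true_and, mem_union] at hp ⊢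
  by_contra! h
  exact hp (h.1.trans h.2)

theorem numDiff_le_card {F : Type u} {X : Type} [Fintype X] (x y : X → F) :
    numDiff x y ≤ Fintype.card X :=
  card_le_univ _

variable {F : Type u} {A κ : Type} [Fintype A] [Fintype κ] [DecidableEq κ]

open Classical in
/-- The coordinates `k` for which `g` and `h` differ somewhere on the intersection of the
hyperplanes `p b = i` and `p e = k`. -/
noncomputable def conflicts (g h : (κ → A) → F) (b e : κ) (i : A) : Finset A :=
  {k | ∃ p : κ → A, p b = i ∧ p e = k ∧ g p ≠ h p}

open Classical in
/-- The coordinates whose hyperplane in direction `b` conflicts with at least `d / 2` of the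
hyperplanes in direction `e`. -/
noncomputable def heavy (d : ℕ) (g h : (κ → A) → F) (b e : κ) : Finset A :=
  {i | d ≤ 2 * #(conflicts g h b e i)}

theorem mem_conflicts {g h : (κ → A) → F} {b e : κ} {i k : A} :
    k ∈ conflicts g h b e i ↔ ∃ p : κ → A, p b = i ∧ p e = k ∧ g p ≠ h p := by
  simp [conflicts]

theorem mem_heavy {d : ℕ} {g h : (κ → A) → F} {b e : κ} {i : A} :
    i ∈ heavy d g h b e ↔ d ≤ 2 * #(conflicts g h b e i) := by
  simp [heavy]

variable [Field F]

/-- On the intersection of two hyperplanes `g - h` is a tensor codeword, so a single conflict there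
costs `d ^ (m - 2)` differences, where `m` is the number of coordinates. A heavy hyperplane has at
least `d / 2` conflicting intersections, hence the factor 2. -/
theorem MinWeight.card_heavy_mul_le {C : Submodule F (A → F)} {d : ℕ} (hC : MinWeight C d)
    {b e : κ} (hbe : b ≠ e) {g h : (κ → A) → F} (hg : g ∈ lineCode C {b}ᶜ)
    (hh : h ∈ lineCode C {e}ᶜ) :
    #(heavy d g h b e) * d ^ (Fintype.card κ - 1) ≤ 2 * numDiff g h := by
  classical
  have hcard : #({b, e}ᶜ : Finset κ) + 2 = Fintype.card κ := by
    rw [← card_pair hbe, card_compl_add_card]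
  have hgh : g - h ∈ lineCode C (({b, e}ᶜ : Finset κ) : Set κ) := by
    refine Submodule.sub_mem _ (lineCode_anti C ?_ hg) (lineCode_anti C ?_ hh) <;>
    · intro c hc
      simp at hc ⊢
      tauto
  refine card_mul_le_of_le_fiber (fun p : κ → A => p b) _ _ _ _ fun i hi => ?_
  have h1 := card_mul_le_of_le_fiber (fun p : κ → A => p e) (conflicts g h b e i)
    {p ∈ ({p | g p ≠ h p} : Finset (κ → A)) | p b = i} (d ^ #({b, e}ᶜ : Finset κ)) 1 fun k hk => by
      obtain ⟨p, hpb, hpe, hp⟩ := mem_conflicts.1 hk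
      rw [one_mul]
      refine (hC.pow_card_le _ _ hgh p (by simpa [sub_eq_zero] using hp)).trans
        (card_le_card fun q hq => ?_)
      simp only [mem_filter, mem_univ, true_and, Pi.sub_apply, ne_eq, sub_eq_zero] at hq ⊢
      exact ⟨⟨hq.1, by rw [hq.2 b (by simp), hpb]⟩, by rw [hq.2 e (by simp), hpe]⟩
  have h2 : Fintype.card κ - 1 = #({b, e}ᶜ : Finset κ) + 1 := by omega
  rw [h2, pow_succ']
  calc d * d ^ #({b, e}ᶜ : Finset κ)
      ≤ 2 * #(conflicts g h b e i) * d ^ #({b, e}ᶜ : Finset κ) :=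
        Nat.mul_le_mul_right _ (mem_heavy.1 hi)
    _ ≤ _ := by
        rw [mul_assoc]
        rw [one_mul] at h1
        exact Nat.mul_le_mul_left _ h1

/-- On the line through `p` in direction `e₂` both `g₀` and `g₁` are codewords, so if they differ at
`p` they differ at `d` or more points of it. At each of these `g₂` contradicts one of the two, but
hyperplanes that are not heavy allow fewer than `d / 2` conflicts each. -/
theorem MinWeight.eq_of_not_mem_heavy {C : Submodule F (A → F)} {d : ℕ} (hC : MinWeight C d)
    {e₀ e₁ e₂ : κ} (h02 : e₀ ≠ e₂) (h12 : e₁ ≠ e₂)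
    {g₀ g₁ g₂ : (κ → A) → F} (hg₀ : g₀ ∈ lineCode C {e₀}ᶜ) (hg₁ : g₁ ∈ lineCode C {e₁}ᶜ)
    {p : κ → A} (hp₀ : p e₀ ∉ heavy d g₀ g₂ e₀ e₂) (hp₁ : p e₁ ∉ heavy d g₁ g₂ e₁ e₂) :
    g₀ p = g₁ p := by
  classical
  by_contra hne
  have hline := C.sub_mem (hg₀ e₂ h02.symm p) (hg₁ e₂ h12.symm p)
  have h := hC _ hline fun h0 => hne (by simpa [sub_eq_zero] using congrFun h0 (p e₂))
  have h' : d ≤ #(conflicts g₀ g₂ e₀ e₂ (p e₀) ∪ conflicts g₁ g₂ e₁ e₂ (p e₁)) := by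
    refine h.trans (card_le_card fun k hk => ?_)
    simp only [mem_filter, mem_univ, true_and, Pi.sub_apply, ne_eq, sub_eq_zero] at hk
    rw [mem_union, mem_conflicts, mem_conflicts]
    by_contra! hcon
    refine hk ((hcon.1 _ (Function.update_of_ne h02 _ _) (Function.update_self _ _ _)).trans
      (hcon.2 _ (Function.update_of_ne h12 _ _) (Function.update_self _ _ _)).symm)
  have h3 := card_union_le (conflicts g₀ g₂ e₀ e₂ (p e₀)) (conflicts g₁ g₂ e₁ e₂ (p e₁))
  rw [mem_heavy] at hp₀ hp₁
  omega

omit [Fintype κ] in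
/-- Two words whose hyperplanes in two directions are codewords, and that are consistent outside
few hyperplanes, extend to a word of the tensor code. -/
theorem MinWeight.exists_mem_lineCode_univ {C : Submodule F (A → F)} {d : ℕ} (hC : MinWeight C d)
    {e₀ e₁ : κ} (h01 : e₀ ≠ e₁) {g₀ g₁ : (κ → A) → F} (hg₀ : g₀ ∈ lineCode C {e₀}ᶜ)
    (hg₁ : g₁ ∈ lineCode C {e₁}ᶜ) (H₀ H₁ : Finset A) (hH₀ : #H₀ < d) (hH₁ : #H₁ < d)
    (h : ∀ p : κ → A, p e₀ ∉ H₀ → p e₁ ∉ H₁ → g₀ p = g₁ p) :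
    ∃ w ∈ lineCode C (Set.univ : Set κ), ∀ p, p e₀ ∉ H₀ → w p = g₀ p := by
  classical
  obtain ⟨E, hEC, hE⟩ := exists_erasure_decoder C (H₀ : Set A)ᶜ
    fun c hc h0 => hC.eq_zero hH₀ hc fun a ha => h0 a (by simpa using ha)
  -- Decode each `e₀`-line of `g₀`, treating the hyperplanes in `H₀` as erased. Linearity of `E`
  -- keeps the other directions in `C`, since those lines become combinations of lines of `g₀`.
  let w : (κ → A) → F := fun p => E (fun i => g₀ (Function.update p e₀ i)) (p e₀)
  have hw : w ∈ lineCode C (Set.univ : Set κ) := by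
    intro c _ y
    by_cases hc : c = e₀
    · subst hc
      simpa [w] using hEC fun i => g₀ (Function.update y c i)
    · have h1 : (fun a => w (Function.update y c a)) = ∑ z, E (Pi.single z 1) (y e₀) •
          fun a => g₀ (Function.update (Function.update y e₀ z) c a) := by
        funext a
        rw [Finset.sum_apply]
        simp only [w]
        rw [linearMap_apply_eq_sum, Function.update_of_ne (Ne.symm hc)]
        refine Finset.sum_congr rfl fun z _ => ?_
        rw [Function.update_comm hc, Pi.smul_apply, smul_eq_mul, mul_comm]
      show (fun a => w (Function.update y c a)) ∈ C
      rw [h1]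
      exact C.sum_mem fun z _ => C.smul_mem _ (hg₀ c hc _)
  -- For `p e₁ ∉ H₁` the unerased part of the `e₀`-line agrees with `g₁`, whose line is a codeword,
  -- so decoding returns the line of `g₁`.
  have hw1 : ∀ p : κ → A, p e₀ ∉ H₀ → p e₁ ∉ H₁ → w p = g₀ p := by
    intro p hp₀ hp₁
    have h1 := hE (fun i => g₀ (Function.update p e₀ i)) _ (hg₁ e₀ h01 p) fun i hi =>
      h _ (by simpa using hi) (by rwa [Function.update_of_ne h01.symm])
    have h2 := congrFun h1 (p e₀)
    rw [Function.update_eq_self] at h2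
    exact h2.trans (h p hp₀ hp₁).symm
  refine ⟨w, hw, fun p hp₀ => ?_⟩
  -- The case `p e₁ ∈ H₁` remains: along `e₁` both words are codewords, and they agree off fewer
  -- than `d` points.
  have h0 := hC.eq_zero hH₁ (C.sub_mem (hw e₁ trivial p) (hg₀ e₁ h01.symm p)) fun a ha => by
    simpa [sub_eq_zero] using hw1 (Function.update p e₁ a)
      (by rwa [Function.update_of_ne h01]) (by rwa [Function.update_self])
  simpa [sub_eq_zero] using congrFun h0 (p e₁)

theorem card_filter_apply_mem [DecidableEq A] (b : κ) (H : Finset A) :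
    #{p : κ → A | p b ∈ H} = #H * Fintype.card A ^ (Fintype.card κ - 1) := by
  have h : ({p : κ → A | p b ∈ H} : Finset (κ → A)) =
      Fintype.piFinset (Function.update (fun _ => univ) b H) := by
    ext p
    simp only [mem_filter, mem_univ, true_and, Fintype.mem_piFinset]
    constructor
    · intro hp c
      by_cases hc : c = b
      · subst hc; simpa using hp
      · simp [Function.update_of_ne hc]
    · intro hp
      simpa using hp b
  rw [h, Fintype.card_piFinset, ← Finset.mul_prod_erase univ _ (mem_univ b), Function.update_self,
    Finset.prod_congr rfl fun c hc => by rw [Function.update_of_ne (Finset.ne_of_mem_erase hc)]]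
  simp [Finset.card_erase_of_mem]

/-- Words whose hyperplanes in three directions are close to codewords are close to a word of the
tensor code. -/
theorem MinWeight.exists_numDiff_le {C : Submodule F (A → F)} {d : ℕ} (hC : MinWeight C d)
    (hd : Fintype.card A ^ Fintype.card κ ≤ 2 * d ^ Fintype.card κ)
    (hd' : Fintype.card A ^ (Fintype.card κ - 1) ≤ 2 * d ^ (Fintype.card κ - 1))
    {e₀ e₁ e₂ : κ} (h01 : e₀ ≠ e₁) (h02 : e₀ ≠ e₂) (h12 : e₁ ≠ e₂)
    {g₀ g₁ g₂ : (κ → A) → F} (hg₀ : g₀ ∈ lineCode C {e₀}ᶜ) (hg₁ : g₁ ∈ lineCode C {e₁}ᶜ)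
    (hg₂ : g₂ ∈ lineCode C {e₂}ᶜ) (r : (κ → A) → F) :
    ∃ w ∈ lineCode C (Set.univ : Set κ),
      numDiff r w ≤ 5 * (numDiff r g₀ + numDiff r g₁ + numDiff r g₂) := by
  classical
  have hκ : Fintype.card κ = (Fintype.card κ - 1) + 1 := by
    have := Fintype.card_pos_iff.2 ⟨e₀⟩
    omega
  have k0 := hC.card_heavy_mul_le h02 hg₀ hg₂
  have k1 := hC.card_heavy_mul_le h12 hg₁ hg₂
  have t0 := numDiff_triangle g₀ r g₂
  have t1 := numDiff_triangle g₁ r g₂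
  rw [numDiff_comm g₀ r] at t0
  rw [numDiff_comm g₁ r] at t1
  -- With `d` heavy hyperplanes the disagreement `x` is at least a quarter of all points, so any
  -- codeword, such as 0, is close enough.
  have big : ∀ k x : ℕ, d ≤ k → k * d ^ (Fintype.card κ - 1) ≤ 2 * x →
      numDiff r 0 ≤ 4 * x := by
    intro k x hk hx
    have h1 := numDiff_le_card r 0
    rw [Fintype.card_fun] at h1
    have h2 : d ^ Fintype.card κ ≤ 2 * x := by
      rw [hκ, pow_succ']
      exact (Nat.mul_le_mul_right _ hk).trans hx
    omega
  by_cases hH₀ : d ≤ #(heavy d g₀ g₂ e₀ e₂)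
  · exact ⟨0, Submodule.zero_mem _, by have := big _ _ hH₀ k0; omega⟩
  by_cases hH₁ : d ≤ #(heavy d g₁ g₂ e₁ e₂)
  · exact ⟨0, Submodule.zero_mem _, by have := big _ _ hH₁ k1; omega⟩
  obtain ⟨w, hw, hwg⟩ := hC.exists_mem_lineCode_univ h01 hg₀ hg₁ _ _ (not_le.1 hH₀) (not_le.1 hH₁)
    fun p => hC.eq_of_not_mem_heavy h02 h12 hg₀ hg₁
  refine ⟨w, hw, ?_⟩
  have h1 : numDiff g₀ w ≤ #{p : κ → A | p e₀ ∈ heavy d g₀ g₂ e₀ e₂} := by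
    refine card_le_card fun p hp => ?_
    simp only [mem_filter, mem_univ, true_and] at hp ⊢
    by_contra hcon
    exact hp (hwg p hcon).symm
  rw [card_filter_apply_mem] at h1
  have h2 := Nat.mul_le_mul_left (#(heavy d g₀ g₂ e₀ e₂)) hd'
  -- The heavy hyperplanes contain at most `4 * numDiff g₀ g₂` points; the triangle inequality
  -- through `r` adds one more `numDiff r g₀`, whence the constant 5.
  have h3 := numDiff_triangle r g₀ w
  rw [mul_left_comm] at h2
  omega

end Agreement

end TensorLTC

namespace TensorLTC

universe u

/-! ### Relative distances -/

section Dist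

variable {F : Type u} {X Y : Type} [Fintype X] [Fintype Y]

theorem relDist_eq (x y : X → F) : relDist x y = numDiff x y / Fintype.card X := by
  unfold relDist numDiff hammingDist
  congr

theorem relDist_nonneg (x y : X → F) : 0 ≤ relDist x y := by
  rw [relDist_eq]
  positivity

theorem relDist_le_one (x y : X → F) : relDist x y ≤ 1 := by
  rw [relDist_eq]
  exact div_le_one_of_le₀ (by exact_mod_cast numDiff_le_card x y) (by positivity)

theorem relDist_self (x : X → F) : relDist x x = 0 := by
  simp [relDist_eq, numDiff]

theorem eq_of_relDist_eq_zero [Nonempty X] {x y : X → F} (h : relDist x y = 0) : x = y := by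
  rw [relDist_eq, div_eq_zero_iff] at h
  rcases h with h | h
  · funext p
    by_contra hp
    have h' : numDiff x y = 0 := by exact_mod_cast h
    classical
    rw [numDiff, Finset.card_eq_zero, Finset.filter_eq_empty_iff] at h'
    exact h' (Finset.mem_univ p) hp
  · simp at h

theorem relDist_comp_equiv (e : X ≃ Y) (x y : Y → F) : relDist (x ∘ e) (y ∘ e) = relDist x y := by
  classical
  rw [relDist_eq, relDist_eq, Fintype.card_congr e]
  congr 2
  exact Finset.card_bij' (fun p _ => e p) (fun p _ => e.symm p) (by simp) (by simp) (by simp)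
    (by simp)

theorem distToCode_nonneg (C : Set (X → F)) (r : X → F) : 0 ≤ distToCode C r :=
  Real.iInf_nonneg fun x => relDist_nonneg r x

theorem distToCode_le {C : Set (X → F)} {x : X → F} (hx : x ∈ C) (r : X → F) :
    distToCode C r ≤ relDist r x :=
  ciInf_le (f := fun x : C => relDist r (x : X → F))
    ⟨0, by rintro _ ⟨y, rfl⟩; exact relDist_nonneg _ _⟩ ⟨x, hx⟩

theorem distToCode_le_one {C : Set (X → F)} (hC : C.Nonempty) (r : X → F) :
    distToCode C r ≤ 1 :=
  (distToCode_le hC.some_mem r).trans (relDist_le_one _ _)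

theorem distToCode_of_mem {C : Set (X → F)} {r : X → F} (hr : r ∈ C) : distToCode C r = 0 :=
  le_antisymm ((distToCode_le hr r).trans_eq (relDist_self r)) (distToCode_nonneg C r)

theorem exists_relDist_eq_distToCode [Finite F] {C : Set (X → F)} (hC : C.Nonempty) (r : X → F) :
    ∃ x ∈ C, relDist r x = distToCode C r := by
  have := hC.to_subtype
  obtain ⟨x, hx⟩ := exists_eq_ciInf_of_finite (f := fun x : C => relDist r (x : X → F))
  exact ⟨x, x.2, hx⟩

theorem mem_of_distToCode_le_zero [Finite F] [Nonempty X] {C : Set (X → F)} (hC : C.Nonempty)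
    {r : X → F} (h : distToCode C r ≤ 0) : r ∈ C := by
  obtain ⟨x, hx, hxr⟩ := exists_relDist_eq_distToCode hC r
  rwa [eq_of_relDist_eq_zero (hxr.trans (le_antisymm h (distToCode_nonneg C r)))]

theorem distToCode_comp_equiv (e : X ≃ Y) {C : Set (X → F)} {C' : Set (Y → F)}
    (h : ∀ x, x ∈ C' ↔ x ∘ e ∈ C) (r : Y → F) : distToCode C (r ∘ e) = distToCode C' r := by
  refine (Equiv.iInf_congr ((e.symm.arrowCongr (Equiv.refl F)).subtypeEquiv h) fun x => ?_).symm
  exact relDist_comp_equiv e r x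

end Dist

namespace Tester

variable {F : Type u} {X : Type} [Fintype X]

theorem IsRobust.mono {T : Tester F X} {α β : ℝ} {C : Set (X → F)} (h : T.IsRobust α C)
    (hβ : β ≤ α) : T.IsRobust β C :=
  ⟨h.1, fun r => (mul_le_mul_of_nonneg_right hβ (distToCode_nonneg C r)).trans (h.2 r)⟩

end Tester

/-! ### Robustness under composition and relabelling -/

namespace OrderedGraph

variable {F : Type u} {L L' D D' : Type} [Fintype L] [Fintype L'] [Fintype D] [Fintype D']

omit [Fintype L] in
theorem tester_robustness (G : OrderedGraph L D) (S : Set (D → F)) (r : L → F) :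
    (G.tester S).robustness r =
      (∑ j : G.R, distToCode S (fun a => r (G.nbr j a))) / Fintype.card G.R :=
  rfl

/-- The robustness of the composed test is the average over `j` of the inner robustness on the view
at `j`, which is at least `β` times the distance of that view from `S`; these distances average to
the outer robustness. -/
theorem isRobust_comp {G : OrderedGraph L D} {G' : OrderedGraph D D'} {C : Set (L → F)}
    {S : Set (D → F)} {S' : Set (D' → F)} {α β : ℝ} (hβ : 0 ≤ β)
    (h : (G.tester S).IsRobust α C) (h' : (G'.tester S').IsRobust β S) :
    ((G.comp G').tester S').IsRobust (β * α) C := by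
  refine ⟨fun r hr s => h'.1 _ (h.1 r hr s.1) s.2, fun r => ?_⟩
  have h1 : ((G.comp G').tester S').robustness r =
      (∑ j, (G'.tester S').robustness (fun a => r (G.nbr j a))) / Fintype.card G.R := by
    unfold Tester.robustness
    rw [← Finset.sum_div, div_div]
    show (∑ s : G.R × G'.R, _) / ((Fintype.card (G.R × G'.R) : ℕ) : ℝ) = _
    rw [Fintype.sum_prod_type, Fintype.card_prod, Nat.cast_mul, mul_comm]
    rfl
  rw [h1, mul_assoc]
  refine (mul_le_mul_of_nonneg_left (h.2 r) hβ).trans ?_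
  unfold Tester.robustness
  rw [← mul_div_assoc, Finset.mul_sum]
  exact div_le_div_of_nonneg_right (Finset.sum_le_sum fun j _ => h'.2 _) (by positivity)

theorem isRobust_relabel {G : OrderedGraph L D} {C : Set (L → F)} {S : Set (D → F)}
    {C' : Set (L' → F)} {S' : Set (D' → F)} (e : L ≃ L') (f : D ≃ D')
    (hC : ∀ r, r ∈ C' ↔ r ∘ e ∈ C) (hS : ∀ x, x ∈ S' ↔ x ∘ f ∈ S) {α : ℝ}
    (h : (G.tester S).IsRobust α C) : ((G.relabel e f).tester S').IsRobust α C' := by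
  have hview : ∀ (r : L' → F) (j : G.R),
      (fun a => r ((G.relabel e f).nbr j a)) ∘ f = fun a => (r ∘ e) (G.nbr j a) := by
    intro r j
    funext a
    simp [relabel]
  refine ⟨fun r hr j => ?_, fun r => ?_⟩
  · refine (hS _).2 ?_
    have h1 := h.1 _ ((hC r).1 hr) j
    exact (hview r j).symm ▸ h1
  · rw [← distToCode_comp_equiv e hC r]
    refine (h.2 (r ∘ e)).trans_eq ?_
    simp only [tester_robustness, ← distToCode_comp_equiv f hS]
    exact congrArg (· / (Fintype.card G.R : ℝ))
      (Finset.sum_congr rfl fun j _ => congrArg (distToCode S) (hview r j).symm)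

/-- A word passing all local checks has robustness 0, hence distance 0 from `C`; over a finite
alphabet the distance is attained. -/
theorem eq_TPC_of_isRobust [Finite F] [Nonempty L] {G : OrderedGraph L D} {C : Set (L → F)}
    {S : Set (D → F)} {α : ℝ} (hα : 0 < α) (hC : C.Nonempty) (h : (G.tester S).IsRobust α C) :
    C = G.TPC S := by
  refine Set.Subset.antisymm (fun r hr => h.1 r hr) fun r hr => ?_
  refine mem_of_distToCode_le_zero hC ?_
  have h1 : (G.tester S).robustness r = 0 := by
    rw [tester_robustness, Finset.sum_eq_zero fun j _ => distToCode_of_mem (hr j), zero_div]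
  have h2 := h.2 r
  rw [h1] at h2
  exact nonpos_of_mul_nonpos_right h2 hα

end OrderedGraph

/-! ### Robustness of the hyperplane test -/

section Product

variable {F : Type u} {A : Type} [Field F] [Fintype A]

theorem mem_tensorPower {C : Submodule F (A → F)} {m : ℕ} {w : (Fin m → A) → F} :
    w ∈ tensorPower C m ↔ ∀ c y, (fun a => w (Function.update y c a)) ∈ C := by
  rw [tensorPower_eq_lineCode, mem_lineCode]
  simp

omit [Field F] in
theorem sum_numDiff_insertNth {m : ℕ} (b : Fin (m + 1)) (r : (Fin (m + 1) → A) → F)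
    (h : A → (Fin m → A) → F) :
    ∑ i, numDiff (fun x => r (b.insertNth i x)) (h i) =
      numDiff r (fun y => h (y b) (b.removeNth y)) := by
  classical
  have h1 : ∀ x y : (Fin (m + 1) → A) → F, numDiff x y = ∑ p, if x p ≠ y p then 1 else 0 := by
    intro x y
    rw [numDiff, Finset.card_filter]
  rw [h1, ← (Fin.insertNthEquiv (fun _ : Fin (m + 1) => A) b).sum_comp, Fintype.sum_prod_type]
  refine Finset.sum_congr rfl fun i _ => ?_
  rw [numDiff, Finset.card_filter]
  refine Finset.sum_congr rfl fun x _ => ?_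
  have h2 : b.removeNth (Fin.insertNthEquiv (fun _ : Fin (m + 1) => A) b (i, x)) = x :=
    Fin.removeNth_insertNth (α := fun _ => A) b i x
  simp only [h2]
  simp only [Fin.insertNthEquiv_apply, Fin.insertNth_apply_same]
  rfl

/-- The nearest codewords on the hyperplanes of direction `b` glue to a word `g b`, and the
robustness is the average over `b` of the relative distance from `r` to `g b`. Averaging over `m +
1` directions when three are used costs the factor `m + 1`; the 5 is that of
`MinWeight.exists_numDiff_le`. -/
theorem productGraph_isRobust [Nonempty A] [Finite F] {C : Submodule F (A → F)} {d m : ℕ}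
    (hC : MinWeight C d) (hm : 2 ≤ m) (hd : Fintype.card A ^ (m + 1) ≤ 2 * d ^ (m + 1))
    (hd' : Fintype.card A ^ m ≤ 2 * d ^ m) :
    ((productGraph A m).tester (tensorPower C m : Set ((Fin m → A) → F))).IsRobust
      (1 / (5 * (m + 1))) (tensorPower C (m + 1)) := by
  refine ⟨fun r hr s => ?_, fun r => ?_⟩
  · refine mem_tensorPower.2 fun c y => ?_
    have h := mem_tensorPower.1 hr (s.1.succAbove c) (s.1.insertNth s.2 y)
    simp only [← Fin.insertNth_update] at h
    exact h
  · have hne : (tensorPower C m : Set ((Fin m → A) → F)).Nonempty := ⟨0, Submodule.zero_mem _⟩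
    choose h hh hdist using fun (b : Fin (m + 1)) (i : A) =>
      exists_relDist_eq_distToCode hne (fun x => r (b.insertNth i x))
    let g : Fin (m + 1) → (Fin (m + 1) → A) → F := fun b y => h b (y b) (b.removeNth y)
    have hg : ∀ b, g b ∈ lineCode C {b}ᶜ := by
      intro b c hc y
      obtain ⟨c', rfl⟩ := Fin.exists_succAbove_eq hc
      have h1 := mem_tensorPower.1 (hh b (y b)) c' (b.removeNth y)
      simp only [← Fin.removeNth_update_succAbove] at h1
      simpa [g] using h1
    obtain ⟨w, hw, hwr⟩ := hC.exists_numDiff_le (κ := Fin (m + 1)) (by simpa using hd)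
      (by simpa using hd') (e₀ := ⟨0, by omega⟩) (e₁ := ⟨1, by omega⟩) (e₂ := ⟨2, by omega⟩)
      (by simp) (by simp) (by simp) (hg _) (hg _) (hg _) r
    have hsum : numDiff r w ≤ 5 * ∑ b, numDiff r (g b) := by
      refine hwr.trans (Nat.mul_le_mul_left _ ?_)
      have h1 := Finset.sum_le_sum_of_subset (f := fun b => numDiff r (g b))
        (Finset.subset_univ ({⟨0, by omega⟩, ⟨1, by omega⟩, ⟨2, by omega⟩} : Finset (Fin (m + 1))))
      rw [Finset.sum_insert (by simp), Finset.sum_insert (by simp), Finset.sum_singleton] at h1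
      omega
    have hrob : ((productGraph A m).tester (tensorPower C m : Set ((Fin m → A) → F))).robustness r
        = (∑ b, numDiff r (g b) : ℕ) / ((m + 1) * (Fintype.card A : ℝ) ^ (m + 1)) := by
      show (∑ s : Fin (m + 1) × A, distToCode (tensorPower C m : Set ((Fin m → A) → F)) (fun x => r (s.1.insertNth s.2 x))) /
        ((Fintype.card (Fin (m + 1) × A) : ℕ) : ℝ) = _
      simp only [← hdist, relDist_eq]
      rw [← Finset.sum_div, div_div, Fintype.sum_prod_type, Nat.cast_sum]
      congr 1
      · refine Finset.sum_congr rfl fun b _ => ?_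
        rw [← sum_numDiff_insertNth b r (h b), Nat.cast_sum]
      · simp only [Fintype.card_prod, Fintype.card_fun, Fintype.card_fin]
        push_cast
        ring
    have hw' : w ∈ tensorPower C (m + 1) := by
      rw [tensorPower_eq_lineCode]
      exact hw
    refine (mul_le_mul_of_nonneg_left (distToCode_le hw' r) (by positivity)).trans ?_
    rw [hrob, relDist_eq, div_mul_div_comm, one_mul]
    have hA : (0 : ℝ) < Fintype.card A := by exact_mod_cast Fintype.card_pos
    simp only [Fintype.card_fun, Fintype.card_fin]
    push_cast
    rw [div_le_div_iff₀ (by positivity) (by positivity)]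
    have h2 : (numDiff r w : ℝ) ≤ 5 * ∑ b, (numDiff r (g b) : ℝ) := by exact_mod_cast hsum
    calc _ ≤ (5 * ∑ b, (numDiff r (g b) : ℝ)) * ((m + 1) * (Fintype.card A : ℝ) ^ (m + 1)) :=
          mul_le_mul_of_nonneg_right h2 (by positivity)
      _ = _ := by ring

/-- Since `(27 / 28) ^ 4 ≥ 1 / 2`, both hyperplane tests apply, with robustness 1/20 and 1/15. -/
theorem graphFourTwo_isRobust [Nonempty A] [Finite F] {C : Submodule F (A → F)} {d : ℕ}
    (hC : MinWeight C d) (hd : 27 * Fintype.card A ≤ 28 * d) :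
    ((graphFourTwo A).tester (tensorPower C 2 : Set ((Fin 2 → A) → F))).IsRobust (1 / 300)
      (tensorPower C 4) := by
  have hpow : ∀ m, (27 * Fintype.card A) ^ m ≤ (28 * d) ^ m := fun m => Nat.pow_le_pow_left hd m
  have h2 := hpow 2
  have h3 := hpow 3
  have h4 := hpow 4
  simp only [mul_pow] at h2 h3 h4
  norm_num at h2 h3 h4
  have k3 := productGraph_isRobust (m := 3) hC (by norm_num) (by norm_num; omega) (by omega)
  have k2 := productGraph_isRobust (m := 2) hC le_rfl (by norm_num; omega) (by omega)
  exact (OrderedGraph.isRobust_comp (by positivity) k3 k2).mono (by norm_num)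

end Product

/-! ### Halving the exponent recursively -/

section Recursion

variable {F : Type u} {A : Type} [Field F]

theorem blockEquiv_apply {k M N : ℕ} (h : k * M = N) (y : Fin k → Fin M → A) (j : Fin N) :
    blockEquiv h y j = y ((finProdFinEquiv.trans (finCongr h)).symm j).1
      ((finProdFinEquiv.trans (finCongr h)).symm j).2 :=
  rfl

theorem blockEquiv_update {k M N : ℕ} (h : k * M = N) (y : Fin k → Fin M → A) (c : Fin k)
    (z : Fin M → A) (c' : Fin M) (a : A) :
    blockEquiv h (Function.update y c (Function.update z c' a)) =
      Function.update (blockEquiv h (Function.update y c z))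
        (finProdFinEquiv.trans (finCongr h) (c, c')) a := by
  funext j
  obtain ⟨⟨i, i'⟩, rfl⟩ := (finProdFinEquiv.trans (finCongr h)).surjective j
  rw [blockEquiv_apply, Equiv.symm_apply_apply]
  by_cases hi : i = c
  · subst hi
    by_cases hi' : i' = c'
    · subst hi'
      simp
    · rw [Function.update_of_ne (a := finProdFinEquiv.trans (finCongr h) (i, i')), blockEquiv_apply,
        Equiv.symm_apply_apply]
      · simp [Function.update_of_ne hi']
      · simpa using hi'
  · rw [Function.update_of_ne (a := finProdFinEquiv.trans (finCongr h) (i, i')), blockEquiv_apply,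
      Equiv.symm_apply_apply]
    · simp [Function.update_of_ne hi]
    · intro h1
      exact hi (congrArg Prod.fst ((finProdFinEquiv.trans (finCongr h)).injective h1))

/-- A line of the iterated power inside a block is a line of the flat power, so the two line
conditions coincide. -/
theorem mem_tensorPower_iff_comp_blockEquiv [Fintype A] (C : Submodule F (A → F)) {k M N : ℕ}
    (h : k * M = N) (w : (Fin N → A) → F) :
    w ∈ tensorPower C N ↔ w ∘ blockEquiv h ∈ tensorPower (tensorPower C M) k := by
  constructor
  · intro hw
    refine mem_tensorPower.2 fun c y => mem_tensorPower.2 fun c' z => ?_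
    simp only [Function.comp_apply, blockEquiv_update]
    exact mem_tensorPower.1 hw _ _
  · intro hw
    refine mem_tensorPower.2 fun j v => ?_
    obtain ⟨⟨c, c'⟩, rfl⟩ := (finProdFinEquiv.trans (finCongr h)).surjective j
    obtain ⟨y, rfl⟩ := (blockEquiv h).surjective v
    have h1 := mem_tensorPower.1 (mem_tensorPower.1 hw c y) c' (y c)
    simp only [Function.comp_apply, blockEquiv_update] at h1
    simpa using h1

theorem MinWeight.tensorPower [Fintype A] {C : Submodule F (A → F)} {d : ℕ}
    (hC : MinWeight C d) (m : ℕ) : MinWeight (tensorPower C m) (d ^ m) := by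
  rw [tensorPower_eq_lineCode]
  simpa using hC.lineCode_univ (κ := Fin m)

/-- Bernoulli's inequality for the relative distance of a tensor power. -/
theorem pow_relative_distance_ge {n d : ℕ} {ε : ℝ} (hn : 0 < n) (hε : ε ≤ 1)
    (h : (1 - ε) * n ≤ d) (M : ℕ) : (1 - M * ε) * (n : ℝ) ^ M ≤ (d : ℝ) ^ M := by
  have h0 := one_add_mul_le_pow (a := -ε) (by linarith) M
  have hn' : (0 : ℝ) < n := by exact_mod_cast hn
  calc (1 - M * ε) * (n : ℝ) ^ M ≤ (1 - ε) ^ M * (n : ℝ) ^ M :=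
        mul_le_mul_of_nonneg_right (by linarith [h0, show (1 + -ε) ^ M = (1 - ε) ^ M by ring])
          (by positivity)
    _ = ((1 - ε) * n) ^ M := (mul_pow _ _ _).symm
    _ ≤ (d : ℝ) ^ M := pow_le_pow_left₀ (mul_nonneg (by linarith) hn'.le) h M

theorem graphFourTwo_block_isRobust [Fintype A] [Nonempty A] [Finite F]
    {C : Submodule F (A → F)} {d : ℕ} (hC : MinWeight C d) (s : ℕ)
    (hd : (1 - 1 / (7 * 2 ^ (s + 2)) : ℝ) * Fintype.card A ≤ d) :
    ((graphFourTwo (Fin (2 ^ s) → A)).tester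
      (tensorPower (tensorPower C (2 ^ s)) 2 : Set ((Fin 2 → Fin (2 ^ s) → A) → F))).IsRobust
      (1 / 300) (tensorPower (tensorPower C (2 ^ s)) 4) := by
  refine graphFourTwo_isRobust (hC.tensorPower (2 ^ s)) ?_
  have h2 : (1 : ℝ) ≤ 2 ^ (s + 2) := one_le_pow₀ (by norm_num)
  have h := pow_relative_distance_ge Fintype.card_pos
    (by rw [div_le_one (by positivity)]; linarith) hd (2 ^ s)
  -- The block code is the power with a quarter of the full exponent, so its distance deficit is at
  -- most a quarter of 1/7, at every level of the recursion.
  have h3 : 1 - ((2 ^ s : ℕ) : ℝ) * (1 / (7 * 2 ^ (s + 2))) = 27 / 28 := by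
    have : (2 : ℝ) ^ s ≠ 0 := by positivity
    push_cast
    rw [pow_add]
    field_simp
    norm_num
  rw [h3] at h
  rw [Fintype.card_fun, Fintype.card_fin]
  have h4 : (27 : ℝ) * (Fintype.card A : ℝ) ^ 2 ^ s ≤ 28 * (d : ℝ) ^ 2 ^ s := by linarith
  exact_mod_cast h4

theorem recGraph_isRobust [Fintype A] [Nonempty A] [Finite F] {C : Submodule F (A → F)} {d : ℕ}
    (hC : MinWeight C d) : ∀ (t : ℕ) (h : 2 ≤ t),
    (1 - 1 / (7 * 2 ^ t) : ℝ) * Fintype.card A ≤ d →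
    ((recGraph A t h).tester (tensorPower C 2 : Set ((Fin 2 → A) → F))).IsRobust
      ((1 / 300) ^ t) (tensorPower C (2 ^ t))
  | 0, h => absurd h (by decide)
  | 1, h => absurd h (by decide)
  | 2, _ => fun hd => by
    refine (graphFourTwo_isRobust hC ?_).mono (by norm_num)
    have h4 : (27 : ℝ) * Fintype.card A ≤ 28 * d := by
      norm_num at hd
      linarith
    exact_mod_cast h4
  | t + 3, _ => fun hd => by
    have hd' : (1 - 1 / (7 * 2 ^ (t + 2)) : ℝ) * Fintype.card A ≤ d := by
      refine le_trans (mul_le_mul_of_nonneg_right ?_ (by positivity)) hd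
      have : (2 : ℝ) ^ (t + 2) ≤ 2 ^ (t + 3) := pow_le_pow_right₀ (by norm_num) (by omega)
      gcongr
    have ih := recGraph_isRobust hC (t + 2) (by omega) hd'
    have hb := OrderedGraph.isRobust_relabel
      (blockEquiv (A := A) (k := 4) (M := 2 ^ (t + 1)) (N := 2 ^ (t + 3)) (by ring))
      (blockEquiv (A := A) (k := 2) (M := 2 ^ (t + 1)) (N := 2 ^ (t + 2)) (by ring))
      (mem_tensorPower_iff_comp_blockEquiv C _) (mem_tensorPower_iff_comp_blockEquiv C _)
      (graphFourTwo_block_isRobust hC (t + 1) hd)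
    have h := OrderedGraph.isRobust_comp (by positivity) hb ih
    refine Tester.IsRobust.mono h ?_
    rw [pow_succ]

end Recursion

end TensorLTC

namespace TensorLTC

universe u

/-! ### Minimum distance and minimum weight -/

section MinDist

variable {F : Type u} {A : Type} [Field F] [Fintype A]

theorem minWeight_minDist (C : Submodule F (A → F)) : MinWeight C (minDist (C : Set (A → F))) := by
  classical
  intro c hc h0
  have h : minDist (C : Set (A → F)) ≤ _ := Nat.sInf_le ⟨c, hc, 0, C.zero_mem, h0, rfl⟩
  refine h.trans ?_
  unfold hammingDist
  apply le_of_eq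
  congr

theorem MinWeight.le_minDist {C : Submodule F (A → F)} {d : ℕ} (hC : MinWeight C d)
    (h0 : C ≠ ⊥) : d ≤ minDist (C : Set (A → F)) := by
  classical
  obtain ⟨c, hc, hc0⟩ := Submodule.exists_mem_ne_zero_of_ne_bot h0
  refine le_csInf ⟨_, c, hc, 0, C.zero_mem, hc0, rfl⟩ ?_
  rintro _ ⟨x, hx, y, hy, hxy, rfl⟩
  refine (hC (x - y) (C.sub_mem hx hy) (sub_ne_zero.2 hxy)).trans ?_
  simp only [hammingDist, Pi.sub_apply, ne_eq, sub_eq_zero]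
  apply le_of_eq
  congr

end MinDist

/-! ### Repetition and soundness -/

namespace Tester

variable {F : Type u} {X : Type}

theorem rejectProb_eq_one_sub (T : Tester F X) (r : X → F) :
    T.rejectProb r = 1 - (Nat.card {s : T.Ω // T.Accepts r s} : ℝ) / Fintype.card T.Ω := by
  classical
  have h : Nat.card {s : T.Ω // T.Accepts r s} + Nat.card {s : T.Ω // ¬ T.Accepts r s} =
      Fintype.card T.Ω := by
    rw [Nat.card_eq_fintype_card, Nat.card_eq_fintype_card, Fintype.card_subtype_compl]
    have := Fintype.card_subtype_le (fun s : T.Ω => T.Accepts r s)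
    omega
  have hΩ : (Fintype.card T.Ω : ℝ) ≠ 0 := by exact_mod_cast Fintype.card_ne_zero
  unfold rejectProb
  rw [eq_sub_iff_add_eq, ← add_div, div_eq_one_iff_eq hΩ, add_comm]
  exact_mod_cast h

theorem rejectProb_nonneg (T : Tester F X) (r : X → F) : 0 ≤ T.rejectProb r := by
  unfold rejectProb
  positivity

theorem rejectProb_le_one (T : Tester F X) (r : X → F) : T.rejectProb r ≤ 1 := by
  rw [rejectProb_eq_one_sub]
  have : 0 ≤ (Nat.card {s : T.Ω // T.Accepts r s} : ℝ) / Fintype.card T.Ω := by positivity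
  linarith

theorem robustness_le_rejectProb (T : Tester F X) (hT : ∀ s, (T.accept s).Nonempty) (r : X → F) :
    T.robustness r ≤ T.rejectProb r := by
  classical
  unfold robustness rejectProb
  refine div_le_div_of_nonneg_right ?_ (by positivity)
  calc ∑ s, distToCode (T.accept s) (T.view r s)
      ≤ ∑ s, if ¬ T.Accepts r s then (1 : ℝ) else 0 := by
        refine Finset.sum_le_sum fun s _ => ?_
        split_ifs with h
        · exact (distToCode_of_mem h).le
        · exact distToCode_le_one (hT s) _
    _ = (Nat.card {s : T.Ω // ¬ T.Accepts r s} : ℝ) := by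
        rw [Finset.sum_boole, Nat.card_eq_fintype_card, Fintype.card_subtype]

theorem iterate_accepts (T : Tester F X) (c : ℕ) (r : X → F) (s : Fin c → T.Ω) :
    (T.iterate c).Accepts r s ↔ ∀ j, T.Accepts r (s j) :=
  Iff.rfl

theorem numQueries_iterate (T : Tester F X) (c : ℕ) :
    (T.iterate c).numQueries = c * T.numQueries := by
  show Fintype.card (Fin c × T.Q) = _
  rw [Fintype.card_prod, Fintype.card_fin]
  rfl

theorem rejectProb_iterate (T : Tester F X) (c : ℕ) (r : X → F) :
    (T.iterate c).rejectProb r = 1 - (1 - T.rejectProb r) ^ c := by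
  rw [rejectProb_eq_one_sub, rejectProb_eq_one_sub, sub_sub_cancel, div_pow]
  have h1 : Nat.card {s : (T.iterate c).Ω // (T.iterate c).Accepts r s} =
      Nat.card {s : T.Ω // T.Accepts r s} ^ c := by
    have e : {s : (T.iterate c).Ω // (T.iterate c).Accepts r s} ≃
        (Fin c → {s : T.Ω // T.Accepts r s}) :=
      Equiv.subtypePiEquivPi (p := fun (_ : Fin c) s => T.Accepts r s)
    rw [Nat.card_congr e, Nat.card_fun, Nat.card_fin]
  have h2 : Fintype.card (T.iterate c).Ω = Fintype.card T.Ω ^ c := by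
    show Fintype.card (Fin c → T.Ω) = _
    rw [Fintype.card_fun, Fintype.card_fin]
  rw [h1, h2]
  push_cast
  rfl

/-- Bernoulli bounds `1 + c * x` by `(1 + x) ^ c`, so `(1 - x) ^ c ≤ 1 / (1 + y)`, which is at most
`1 - y / 2` on the unit interval. -/
theorem one_sub_pow_le {x y : ℝ} (hx0 : 0 ≤ x) (hx1 : x ≤ 1) (hy0 : 0 ≤ y) (hy1 : y ≤ 1) (c : ℕ)
    (h : y ≤ c * x) : (1 - x) ^ c ≤ 1 - y / 2 := by
  have h1 : (1 - x) ^ c * (1 + c * x) ≤ 1 :=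
    calc (1 - x) ^ c * (1 + c * x) ≤ (1 - x) ^ c * (1 + x) ^ c :=
          mul_le_mul_of_nonneg_left (one_add_mul_le_pow (by linarith) c)
            (pow_nonneg (by linarith) c)
      _ = (1 - x ^ 2) ^ c := by rw [← mul_pow]; ring
      _ ≤ 1 := pow_le_one₀ (by nlinarith) (by nlinarith)
  have h2 : 0 ≤ (1 - x) ^ c := pow_nonneg (by linarith) c
  have h3 : (1 - x) ^ c * (1 + y) ≤ 1 :=
    (mul_le_mul_of_nonneg_left (by linarith) h2).trans h1
  nlinarith

variable [Fintype X]

/-- Repeating a robust tester often enough gives a tester with constant soundness. -/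
theorem IsRobust.iterate_tests {T : Tester F X} {α : ℝ} {C : Set (X → F)} (hC : C.Nonempty)
    (h : T.IsRobust α C) (hT : ∀ s, (T.accept s).Nonempty) {c : ℕ} (hc : 1 ≤ c * α) :
    (T.iterate c).Tests C := by
  refine ⟨fun r hr s => (iterate_accepts T c r s).2 fun j => h.1 r hr (s j), fun r _ => ?_⟩
  rw [rejectProb_iterate]
  have h1 := (h.2 r).trans (robustness_le_rejectProb T hT r)
  have h0 := distToCode_nonneg C r
  have h2 : distToCode C r ≤ c * T.rejectProb r :=
    calc distToCode C r ≤ (c * α) * distToCode C r := le_mul_of_one_le_left h0 hc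
      _ = c * (α * distToCode C r) := mul_assoc _ _ _
      _ ≤ _ := mul_le_mul_of_nonneg_left h1 (by positivity)
  have := one_sub_pow_le (T.rejectProb_nonneg r) (T.rejectProb_le_one r) h0
    (distToCode_le_one hC r) c h2
  linarith

/-- The tester that reads the whole word. -/
def readAll (C : Set (X → F)) : Tester F X where
  Ω := Unit
  Q := X
  query _ a := a
  accept _ := C

theorem readAll_tests {C : Set (X → F)} (hC : C.Nonempty) : (readAll C).Tests C := by
  refine ⟨fun r hr _ => hr, fun r hr => ?_⟩
  have h1 : (readAll C).rejectProb r = 1 := by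
    rw [rejectProb_eq_one_sub]
    have : IsEmpty {s : (readAll C).Ω // (readAll C).Accepts r s} := ⟨fun s => hr s.2⟩
    simp
  rw [h1]
  linarith [distToCode_le_one hC r]

end Tester

/-- A polynomial is bounded on the integers `k ≥ 2` by a power of `k`. -/
theorem exists_eval_le_pow (p : Polynomial ℝ) :
    ∃ c : ℕ, ∀ k : ℕ, 2 ≤ k → p.eval (k : ℝ) ≤ (k : ℝ) ^ c := by
  obtain ⟨a, ha⟩ := pow_unbounded_of_one_lt (∑ i ∈ Finset.range (p.natDegree + 1), |p.coeff i|)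
    (one_lt_two (α := ℝ))
  refine ⟨a + p.natDegree, fun k hk => ?_⟩
  have hk' : (2 : ℝ) ≤ k := by exact_mod_cast hk
  rw [Polynomial.eval_eq_sum_range, pow_add]
  calc ∑ i ∈ Finset.range (p.natDegree + 1), p.coeff i * (k : ℝ) ^ i
      ≤ ∑ i ∈ Finset.range (p.natDegree + 1), |p.coeff i| * (k : ℝ) ^ p.natDegree := by
        refine Finset.sum_le_sum fun i hi => mul_le_mul (le_abs_self _)
          (pow_le_pow_right₀ (by linarith) (Nat.lt_succ_iff.1 (Finset.mem_range.1 hi)))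
          (by positivity) (abs_nonneg _)
    _ = (∑ i ∈ Finset.range (p.natDegree + 1), |p.coeff i|) * (k : ℝ) ^ p.natDegree := by
        rw [Finset.sum_mul]
    _ ≤ (k : ℝ) ^ a * (k : ℝ) ^ p.natDegree :=
        mul_le_mul_of_nonneg_right (ha.le.trans (pow_le_pow_left₀ (by norm_num) hk' a))
          (by positivity)

/-! ### Parameters of the tester and of the code -/

section Family

variable {F : Type u} [Field F] {n : ℕ}

/-- The tester for the `2 ^ t`-th tensor power: repeat the recursively composed test, or read the
whole word if `t < 2`. -/
noncomputable def ltcTester (C : Submodule F (Fin n → F)) [NeZero n] (t : ℕ) :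
    Tester F (Fin (2 ^ t) → Fin n) :=
  if h : 2 ≤ t then
    ((recGraph (Fin n) t h).tester (tensorPower C 2 : Set ((Fin 2 → Fin n) → F))).iterate (300 ^ t)
  else Tester.readAll (tensorPower C (2 ^ t) : Set ((Fin (2 ^ t) → Fin n) → F))

variable [NeZero n] {C : Submodule F (Fin n → F)} {t : ℕ}

theorem numQueries_ltcTester_le :
    ((ltcTester C t).numQueries : ℝ) ≤ 1 * (n : ℝ) ^ 2 * ((2 : ℝ) ^ t) ^ 9 := by
  have hn : (1 : ℝ) ≤ n := by exact_mod_cast NeZero.one_le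
  unfold ltcTester
  split_ifs with h
  · rw [Tester.numQueries_iterate]
    have h1 : ((recGraph (Fin n) t h).tester
        (tensorPower C 2 : Set ((Fin 2 → Fin n) → F))).numQueries = n ^ 2 := by
      show Fintype.card (Fin 2 → Fin n) = n ^ 2
      simp
    rw [h1]
    push_cast
    rw [one_mul, mul_comm, ← pow_mul, mul_comm t, pow_mul]
    -- The exponent 9 comes from `300 ≤ 2 ^ 9`.
    exact mul_le_mul_of_nonneg_left (pow_le_pow_left₀ (by norm_num) (by norm_num) t)
      (by positivity)
  · have h1 : (Tester.readAll (tensorPower C (2 ^ t) :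
        Set ((Fin (2 ^ t) → Fin n) → F))).numQueries = n ^ 2 ^ t := by
      show Fintype.card (Fin (2 ^ t) → Fin n) = n ^ 2 ^ t
      simp
    rw [h1]
    push_cast
    have h2 : 2 ^ t ≤ 2 := by
      have : t = 0 ∨ t = 1 := by omega
      rcases this with rfl | rfl <;> norm_num
    rw [one_mul]
    calc (n : ℝ) ^ 2 ^ t ≤ (n : ℝ) ^ 2 := pow_le_pow_right₀ hn h2
      _ ≤ _ := le_mul_of_one_le_right (by positivity)
        (one_le_pow₀ (one_le_pow₀ (by norm_num)))

theorem recGraph_minDist_isRobust [Finite F]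
    (hd : (1 : ℝ) - 1 / (7 * (2 : ℝ) ^ t) ≤ (minDist (C : Set (Fin n → F)) : ℝ) / (n : ℝ))
    (h : 2 ≤ t) :
    ((recGraph (Fin n) t h).tester (tensorPower C 2 : Set ((Fin 2 → Fin n) → F))).IsRobust
      ((1 / 300) ^ t) (tensorPower C (2 ^ t)) := by
  refine recGraph_isRobust (minWeight_minDist C) t h ?_
  have hn : (0 : ℝ) < n := by exact_mod_cast NeZero.pos n
  rw [Fintype.card_fin]
  exact (le_div_iff₀ hn).1 hd

theorem ltcTester_tests [Finite F]
    (hd : (1 : ℝ) - 1 / (7 * (2 : ℝ) ^ t) ≤ (minDist (C : Set (Fin n → F)) : ℝ) / (n : ℝ)) :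
    (ltcTester C t).Tests (tensorPower C (2 ^ t) : Set ((Fin (2 ^ t) → Fin n) → F)) := by
  unfold ltcTester
  split_ifs with h
  · refine (recGraph_minDist_isRobust hd h).iterate_tests ⟨0, Submodule.zero_mem _⟩
      (fun _ => ⟨0, Submodule.zero_mem _⟩) ?_
    push_cast
    rw [← mul_pow]
    norm_num
  · exact Tester.readAll_tests ⟨0, Submodule.zero_mem _⟩

theorem minDist_tensorPower_ge (hk : 2 ≤ Module.finrank F C)
    (hd : (1 : ℝ) - 1 / (7 * (2 : ℝ) ^ t) ≤ (minDist (C : Set (Fin n → F)) : ℝ) / (n : ℝ)) :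
    6 / 7 ≤ (minDist (tensorPower C (2 ^ t) : Set ((Fin (2 ^ t) → Fin n) → F)) : ℝ) /
      ((n : ℝ) ^ 2 ^ t) := by
  have hn : (0 : ℝ) < n := by exact_mod_cast NeZero.pos n
  have hne : tensorPower C (2 ^ t) ≠ ⊥ := by
    intro h
    have h1 := pow_finrank_le_finrank_tensorPower C (2 ^ t)
    rw [h, finrank_bot] at h1
    have : 0 < Module.finrank F C ^ 2 ^ t := by positivity
    omega
  have h1 := ((minWeight_minDist C).tensorPower (2 ^ t)).le_minDist hne
  have h2 : (1 : ℝ) ≤ 2 ^ t := one_le_pow₀ (by norm_num)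
  have h3 := pow_relative_distance_ge (NeZero.pos n)
    (by rw [div_le_one (by positivity)]; linarith) ((le_div_iff₀ hn).1 hd) (2 ^ t)
  have h4 : 1 - ((2 ^ t : ℕ) : ℝ) * (1 / (7 * 2 ^ t)) = 6 / 7 := by
    push_cast
    field_simp
    norm_num
  rw [h4] at h3
  rw [le_div_iff₀ (by positivity)]
  exact h3.trans (by exact_mod_cast h1)

end Family

end TensorLTC

theorem mainTheorem2 {F : ℕ → Type*} [∀ i, Field (F i)] [∀ i, Finite (F i)]
    (n t : ℕ → ℕ) [∀ i, NeZero (n i)]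
    (C : ∀ i, Submodule (F i) (Fin (n i) → F i))
    (hk : ∀ i, 2 ≤ Module.finrank (F i) (C i))
    (p : Polynomial ℝ)
    (hp : ∀ i, (n i : ℝ) ≤ p.eval (Module.finrank (F i) (C i) : ℝ))
    (hd : ∀ i, 1 - 1 / (7 * (2 : ℝ) ^ t i) ≤
      (TensorLTC.minDist (C i : Set (Fin (n i) → F i)) : ℝ) / (n i : ℝ)) :
    -- inverse polynomial rate
    (∃ c : ℕ, ∀ i, n i ^ 2 ^ t i ≤
      Module.finrank (F i) (TensorLTC.tensorPower (C i) (2 ^ t i)) ^ c) ∧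
    -- constant relative distance
    (∃ δ : ℝ, 0 < δ ∧ ∀ i, δ ≤
      (TensorLTC.minDist (TensorLTC.tensorPower (C i) (2 ^ t i) :
        Set ((Fin (2 ^ t i) → Fin (n i)) → F i)) : ℝ) / ((n i : ℝ) ^ 2 ^ t i)) ∧
    -- local testability
    ∃ (T : ∀ i, TensorLTC.Tester (F i) (Fin (2 ^ t i) → Fin (n i))) (α : ℝ),
      0 < α ∧
      (∀ i, (T i).Tests
        (TensorLTC.tensorPower (C i) (2 ^ t i) : Set ((Fin (2 ^ t i) → Fin (n i)) → F i))) ∧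
      -- the testers check projections onto the tensor square
      (∀ i (h : 2 ≤ t i),
        (TensorLTC.tensorPower (C i) (2 ^ t i) : Set ((Fin (2 ^ t i) → Fin (n i)) → F i)) =
          (TensorLTC.recGraph (Fin (n i)) (t i) h).TPC (TensorLTC.tensorPower (C i) 2) ∧
        ((TensorLTC.recGraph (Fin (n i)) (t i) h).tester
            (TensorLTC.tensorPower (C i) 2 : Set ((Fin 2 → Fin (n i)) → F i))).IsRobust
          (α ^ t i) (TensorLTC.tensorPower (C i) (2 ^ t i)) ∧
        ∃ r : ℕ, T i = ((TensorLTC.recGraph (Fin (n i)) (t i) h).tester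
            (TensorLTC.tensorPower (C i) 2 : Set ((Fin 2 → Fin (n i)) → F i))).iterate r) ∧
      -- the number of queries
      (∃ (B : ℝ) (b : ℕ), ∀ i,
        ((T i).numQueries : ℝ) ≤ B * (n i : ℝ) ^ 2 * ((2 : ℝ) ^ t i) ^ b) ∧
      (∀ (A : ℝ) (a : ℕ),
        (∀ i, (n i : ℝ) ≤ A * Real.log ((n i : ℝ) ^ 2 ^ t i) ^ a) →
        ∃ (B : ℝ) (b : ℕ), ∀ i,
          ((T i).numQueries : ℝ) ≤ B * Real.log ((n i : ℝ) ^ 2 ^ t i) ^ b) := by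
  refine ⟨?_, ⟨6 / 7, by norm_num, fun i => TensorLTC.minDist_tensorPower_ge (hk i) (hd i)⟩,
    fun i => TensorLTC.ltcTester (C i) (t i), 1 / 300, by norm_num,
    fun i => TensorLTC.ltcTester_tests (hd i), fun i h => ?_,
    ⟨1, 9, fun i => TensorLTC.numQueries_ltcTester_le⟩, fun A a hA => ?_⟩
  -- A bound `n ≤ k ^ c` is preserved by tensoring, with the same `c`, as length and dimension bound
  -- are both raised to the power `m`.
  · obtain ⟨c, hc⟩ := TensorLTC.exists_eval_le_pow p
    refine ⟨c, fun i => ?_⟩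
    have h1 : n i ≤ Module.finrank (F i) (C i) ^ c := by
      exact_mod_cast (hp i).trans (hc _ (hk i))
    calc n i ^ 2 ^ t i ≤ (Module.finrank (F i) (C i) ^ c) ^ 2 ^ t i := Nat.pow_le_pow_left h1 _
      _ = (Module.finrank (F i) (C i) ^ 2 ^ t i) ^ c := by rw [← pow_mul, ← pow_mul, mul_comm]
      _ ≤ _ := Nat.pow_le_pow_left
        (TensorLTC.pow_finrank_le_finrank_tensorPower (C i) (2 ^ t i)) _
  · have hrob := TensorLTC.recGraph_minDist_isRobust (hd i) h
    refine ⟨TensorLTC.OrderedGraph.eq_TPC_of_isRobust (by positivity) ⟨0, Submodule.zero_mem _⟩ hrob,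
      hrob, 300 ^ t i, ?_⟩
    simp only [TensorLTC.ltcTester, dif_pos h]
  · refine ⟨A ^ 2 * (1 / Real.log 2) ^ 9, 2 * a + 9, fun i => ?_⟩
    have hn : 2 ≤ n i := (hk i).trans (by simpa using Submodule.finrank_le (C i))
    have hn' : (2 : ℝ) ≤ n i := by exact_mod_cast hn
    have hl2 : 0 < Real.log 2 := Real.log_pos (by norm_num)
    -- As `n ≥ k ≥ 2`, the logarithm of the length is at least `m * log 2`, so powers of `m` are
    -- polylogarithmic too.
    have hlog : (2 : ℝ) ^ t i ≤ 1 / Real.log 2 * Real.log ((n i : ℝ) ^ 2 ^ t i) := by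
      rw [Real.log_pow, one_div_mul_eq_div, le_div_iff₀ hl2]
      push_cast
      exact mul_le_mul_of_nonneg_left (Real.log_le_log (by norm_num) hn') (by positivity)
    refine TensorLTC.numQueries_ltcTester_le.trans ?_
    calc 1 * (n i : ℝ) ^ 2 * ((2 : ℝ) ^ t i) ^ 9
        ≤ 1 * (A * Real.log ((n i : ℝ) ^ 2 ^ t i) ^ a) ^ 2 *
            (1 / Real.log 2 * Real.log ((n i : ℝ) ^ 2 ^ t i)) ^ 9 := by
          have h1 := pow_le_pow_left₀ (by positivity) (hA i) 2
          have h2 := pow_le_pow_left₀ (by positivity) hlog 9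
          rw [one_mul, one_mul]
          exact mul_le_mul h1 h2 (by positivity) (sq_nonneg _)
      _ = _ := by ring
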